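/- Let $\mathcal H$ be a separable complex Hilbert space. **The category $\mathcal O$.** Its objects are the bounded self-adjoint operators on $\mathcal H$. There is exactly one morphism $f_{\mathcal O}:B\to A$ if $B=f(A)$ for some bounded Borel function $f:\sigma(A)\to\mathbb R$, and none otherwise. For $A\in\mathcal O$ let $W_A=\{E[A\in\Delta]\mid\Delta\subseteq\sigma(A)\text{ Borel}\}$ be the set of spectral projectors of $A$, ordered as projectors. **Coarse-graining.** For $A\in\mathcal O$, a Borel set $\Delta\subseteq\sigma(A)$ and a bounded Borel function $f:\sigma(A)\to\mathbb R$ put $$E[f(A)\in f(\Delta)]:=\inf\{Q\in W_{f(A)}\mid E[A\in\Delta]\le Q\},$$ the infimum being taken in the lattice of all projectors on $\mathcal H$; it lies in $W_{f(A)}$. The coarse-graining presheaf $\mathbf G:\mathcal O^{\rm op}\to{\rm Set}$ is given by $\mathbf G(A)=W_A$ and $\mathbf G(f_{\mathcal O})(E[A\in\Delta])=E[f(A)\in f(\Delta)]$. **The subobject classifier.** $\boldsymbol\Omega:\mathcal O^{\rm op}\to{\rm Set}$ is the presheaf for which $\boldsymbol\Omega(A)$ is the set of sieves on $A$ in $\mathcal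 O$, ordered by inclusion, with least element $0_A=\emptyset$ and greatest element ${\rm true}_A$ (all morphisms with codomain $A$), and $\boldsymbol\Omega(f_{\mathcal O})=f_{\mathcal O}^*$ is the pull-back of sieves. **Generalized valuations.** A generalized valuation $\nu$ is a family of maps $\nu_A:W_A\to\boldsymbol\Omega(A)$, $A\in\mathcal O$, such that for all $A$: 1. $\nu_{h(A)}(E[h(A)\in h(\Delta)])=h_{\mathcal O}^*(\nu_A(E[A\in\Delta]))$ for every bounded Borel $h:\sigma(A)\to\mathbb R$ and every Borel $\Delta\subseteq\sigma(A)$; 2. $\nu_A(0)=0_A$; 3. if $\alpha,\beta\in W_A$ and $\alpha\le\beta$, then $\nu_A(\alpha)\le\nu_A(\beta)$; 4. if $\alpha,\beta\in W_A$, $\alpha\beta=0$ and $\nu_A(\alpha)={\rm true}_A$, then $\nu_A(\beta)<{\rm true}_A$. **Theorem.** Let $\nu$ be a generalized valuation. Then the maps $N^\nu_A(P):=\nu_A(P)$, $P\in W_A$, are the components of a natural transformation $N^\nu:\mathbf G\to\boldsymbol\Omega$. Consequently $\nu$ corresponds to a subobject of $\mathbf G$: the sets $\mathbf K^\nu(A)=\{P\in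 W_A\mid\nu_A(P)={\rm true}_A\}$ form a subpresheaf $\mathbf K^\nu$ of $\mathbf G$, and $\mathbf K^\nu$ is the one and only subpresheaf of $\mathbf G$ whose characteristic morphism $\mathbf G\to\boldsymbol\Omega$ is $N^\nu$. -/

import Mathlib

namespace QuantumTopos

open MeasureTheory CategoryTheory Filter Topology
open scoped CompactlySupported ENNReal

/-- A bounded self-adjoint operator on the complex Hilbert space `H`. -/
@[ext]
structure SelfAdjointOp (H : Type*) [NormedAddCommGroup H] [InnerProductSpace ℂ H]
    [CompleteSpace H] where
  /-- the underlying bounded operator -/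
  toCLM : H →L[ℂ] H
  isSelfAdjoint : IsSelfAdjoint toCLM

theorem ext_of_inner {H : Type*} [NormedAddCommGroup H] [InnerProductSpace ℂ H]
    {S T : H →L[ℂ] H}
    (h : ∀ ψ, inner ℂ ψ (S ψ) = inner ℂ ψ (T ψ)) : S = T := by
  have := (ext_inner_map (S : H →ₗ[ℂ] H) (T : H →ₗ[ℂ] H)).1 fun x => by
    have := congrArg (starRingEnd ℂ) (h x)
    simpa only [inner_conj_symm] using! this
  ext x
  exact congrArg (fun L : H →ₗ[ℂ] H => L x) this

variable {H : Type*} [NormedAddCommGroup H] [InnerProductSpace ℂ H] [CompleteSpace H]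

namespace SelfAdjointOp

variable (A : SelfAdjointOp H)

/-- The spectrum `σ(A) ⊆ ℝ`. -/
abbrev spec : Set ℝ := spectrum ℝ A.toCLM

/-- The continuous functional calculus `g ↦ g(A)` on `C(σ(A), ℝ)`. -/
noncomputable abbrev contCalc : C(A.spec, ℝ) →⋆ₐ[ℝ] (H →L[ℂ] H) :=
  cfcHom (p := IsSelfAdjoint) A.isSelfAdjoint

theorem cfc_isSelfAdjoint (g : C(A.spec, ℝ)) : IsSelfAdjoint (A.contCalc g) := by
  have : IsSelfAdjoint g := by
    ext x
    simp
  exact this.map A.contCalc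

theorem inner_cfc_symm (g : C(A.spec, ℝ)) (φ ψ : H) :
    inner ℂ (A.contCalc g φ) ψ = inner ℂ φ (A.contCalc g ψ) :=
  (ContinuousLinearMap.isSelfAdjoint_iff_isSymmetric.1 (A.cfc_isSelfAdjoint g)) φ ψ

theorem inner_cfc_mul_self (g : C(A.spec, ℝ)) (ψ : H) :
    inner ℂ ψ (A.contCalc (g * g) ψ) = ((‖A.contCalc g ψ‖ ^ 2 : ℝ) : ℂ) := by
  rw [map_mul, mul_apply_eq_comp, ← inner_cfc_symm, inner_self_eq_norm_sq_to_K]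
  simp

theorem inner_cfc_self (g : C(A.spec, ℝ)) (ψ : H) :
    inner ℂ ψ (A.contCalc g ψ) = (((inner ℂ ψ (A.contCalc g ψ) : ℂ).re : ℝ) : ℂ) := by
  refine (Complex.conj_eq_iff_re.1 ?_).symm
  rw [inner_conj_symm, inner_cfc_symm]

/-- The positive functional `g ↦ ⟨ψ, g(A) ψ⟩` on the continuous functions on `σ(A)`. -/
noncomputable def functional (ψ : H) : C_c(A.spec, ℝ) →ₚ[ℝ] ℝ :=
  PositiveLinearMap.mk₀
    { toFun := fun g => (inner ℂ ψ (A.contCalc g.toContinuousMap ψ)).re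
      map_add' := fun g₁ g₂ => by
        have : (g₁ + g₂).toContinuousMap = g₁.toContinuousMap + g₂.toContinuousMap := rfl
        rw [this, map_add, add_apply, inner_add_right, Complex.add_re]
      map_smul' := fun c g => by
        have : (c • g).toContinuousMap = c • g.toContinuousMap := rfl
        rw [this, map_smul, smul_apply, ← Complex.coe_smul, inner_smul_right]
        simp }
    (fun g hg => by
      have h : g.toContinuousMap = (⟨fun x => √(g x), by fun_prop⟩ : C(A.spec, ℝ)) *
          ⟨fun x => √(g x), by fun_prop⟩ := by
        ext x
        exact (Real.mul_self_sqrt (hg x)).symm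
      change 0 ≤ (inner ℂ ψ (A.contCalc g.toContinuousMap ψ)).re
      rw [h, inner_cfc_mul_self, Complex.ofReal_re]
      positivity)

/-- The scalar spectral measure `Δ ↦ ⟨ψ, E[A ∈ Δ] ψ⟩` of `A` in the vector `ψ`: the Borel measure
on `σ(A)` that represents the functional `g ↦ ⟨ψ, g(A) ψ⟩`. -/
noncomputable def spectralMeasure (ψ : H) : Measure A.spec :=
  RealRMK.rieszMeasure (A.functional ψ)

instance (ψ : H) : IsFiniteMeasure (A.spectralMeasure ψ) := by
  unfold spectralMeasure; infer_instance

instance (ψ : H) : (A.spectralMeasure ψ).Regular := by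
  unfold spectralMeasure; infer_instance

theorem integral_spectralMeasure (g : C(A.spec, ℝ)) (ψ : H) :
    ((∫ x, g x ∂(A.spectralMeasure ψ) : ℝ) : ℂ) = inner ℂ ψ (A.contCalc g ψ) := by
  rw [inner_cfc_self]
  congr 1
  exact RealRMK.integral_rieszMeasure (A.functional ψ)
    (CompactlySupportedContinuousMap.continuousMapEquiv g)

theorem norm_cfc_sq (g : C(A.spec, ℝ)) (ψ : H) :
    ‖A.contCalc g ψ‖ ^ 2 = ∫ x, g x ^ 2 ∂(A.spectralMeasure ψ) := by
  have := A.integral_spectralMeasure (g * g) ψ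
  rw [inner_cfc_mul_self] at this
  rw [← Complex.ofReal_inj, ← this]
  congr 2
  ext x
  simp [sq]

theorem eLpNorm_two_toReal_sq {X : Type*} [MeasurableSpace X] {μ : Measure X} {f : X → ℝ}
    (hf : MemLp f 2 μ) : (eLpNorm f 2 μ).toReal ^ 2 = ∫ x, f x ^ 2 ∂μ := by
  rw [hf.eLpNorm_eq_integral_rpow_norm (by norm_num) (by norm_num), ENNReal.toReal_ofReal
    (by positivity)]
  have h0 : 0 ≤ ∫ x, f x ^ 2 ∂μ := integral_nonneg fun x => sq_nonneg _
  simp only [ENNReal.toReal_ofNat, Real.rpow_ofNat, Real.norm_eq_abs, sq_abs]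
  rw [← Real.rpow_natCast, ← Real.rpow_mul h0]
  norm_num

theorem memLp_continuous (g : C(A.spec, ℝ)) (μ : Measure A.spec) [IsFiniteMeasure μ] :
    MemLp g 2 μ := by
  refine MemLp.of_bound (C := ‖g‖) g.continuous.aestronglyMeasurable ?_
  exact ae_of_all _ fun x => g.norm_coe_le_norm x

theorem norm_cfc (g : C(A.spec, ℝ)) (ψ : H) :
    ‖A.contCalc g ψ‖ = (eLpNorm g 2 (A.spectralMeasure ψ)).toReal := by
  have h := A.norm_cfc_sq g ψ
  rw [← eLpNorm_two_toReal_sq (A.memLp_continuous g _)] at h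
  exact (pow_left_inj₀ (norm_nonneg _) ENNReal.toReal_nonneg two_ne_zero).1 h

theorem exists_approx {f : A.spec → ℝ} (μ : Measure A.spec) [IsFiniteMeasure μ]
    [μ.WeaklyRegular] (hf : MemLp f 2 μ) :
    ∃ g : ℕ → C(A.spec, ℝ), Tendsto (fun n => eLpNorm (⇑(g n) - f) 2 μ) atTop (𝓝 0) := by
  have : ∀ n : ℕ, ∃ g : C(A.spec, ℝ), eLpNorm (⇑g - f) 2 μ ≤ ((n : ℝ≥0∞) + 1)⁻¹ := by
    intro n
    obtain ⟨g, hg, -⟩ := hf.exists_boundedContinuous_eLpNorm_sub_le (by norm_num)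
      (ε := ((n : ℝ≥0∞) + 1)⁻¹) (by simp)
    exact ⟨g.toContinuousMap, by rw [eLpNorm_sub_comm]; exact hg⟩
  choose g hg using this
  refine ⟨g, tendsto_of_tendsto_of_tendsto_of_le_of_le tendsto_const_nhds ?_
    (fun _ => zero_le) hg⟩
  have := (tendsto_add_atTop_iff_nat 1).2 ENNReal.tendsto_inv_nat_nhds_zero
  simpa using this

theorem exists_vec {f : A.spec → ℝ} (ψ : H) (hf : MemLp f 2 (A.spectralMeasure ψ)) :
    ∃ v : H, ∀ g : ℕ → C(A.spec, ℝ),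
      Tendsto (fun n => eLpNorm (⇑(g n) - f) 2 (A.spectralMeasure ψ)) atTop (𝓝 0) →
      Tendsto (fun n => A.contCalc (g n) ψ) atTop (𝓝 v) := by
  set μ := A.spectralMeasure ψ
  have key : ∀ g g' : C(A.spec, ℝ), ENNReal.ofReal ‖A.contCalc g ψ - A.contCalc g' ψ‖ ≤
      eLpNorm (⇑g - f) 2 μ + eLpNorm (⇑g' - f) 2 μ := by
    intro g g'
    rw [← sub_apply, ← map_sub, norm_cfc, ENNReal.ofReal_toReal
      (A.memLp_continuous _ _).2.ne]
    have : (⇑(g - g') : A.spec → ℝ) = (⇑g - f) - (⇑g' - f) := by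
      ext x; simp
    rw [this]
    exact eLpNorm_sub_le ((A.memLp_continuous g μ).sub hf).1
      ((A.memLp_continuous g' μ).sub hf).1 (by norm_num)
  obtain ⟨g₀, hg₀⟩ := A.exists_approx μ hf
  have hc : CauchySeq (fun n => A.contCalc (g₀ n) ψ) := by
    refine EMetric.cauchySeq_iff.2 fun ε hε => ?_
    have h2 : (0 : ℝ≥0∞) < ε / 2 := ENNReal.half_pos hε.ne'
    obtain ⟨N, hN⟩ := eventually_atTop.1 (hg₀.eventually (gt_mem_nhds h2))
    refine ⟨N, fun m hm n hn => ?_⟩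
    rw [edist_dist, dist_eq_norm]
    refine (key _ _).trans_lt ?_
    calc _ < ε / 2 + ε / 2 := ENNReal.add_lt_add (hN m hm) (hN n hn)
      _ = ε := ENNReal.add_halves ε
  obtain ⟨v, hv⟩ := cauchySeq_tendsto_of_complete hc
  refine ⟨v, fun g hg => ?_⟩
  have hz : Tendsto (fun n => A.contCalc (g n) ψ - A.contCalc (g₀ n) ψ) atTop (𝓝 0) := by
    rw [tendsto_zero_iff_norm_tendsto_zero]
    have h1 : Tendsto (fun n => ENNReal.ofReal ‖A.contCalc (g n) ψ - A.contCalc (g₀ n) ψ‖) atTop (𝓝 0) :=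
      tendsto_of_tendsto_of_tendsto_of_le_of_le tendsto_const_nhds
        (by simpa using hg.add hg₀) (fun _ => zero_le) (fun n => key _ _)
    have h2 := (ENNReal.tendsto_toReal ENNReal.zero_ne_top).comp h1
    simpa [Function.comp_def, ENNReal.toReal_ofReal] using h2
  simpa using hz.add hv

theorem spectralMeasure_univ (ψ : H) : (A.spectralMeasure ψ).real Set.univ = ‖ψ‖ ^ 2 := by
  have := A.norm_cfc_sq 1 ψ
  simpa [Measure.real] using this.symm

/-- Existence of the operator `f(A)` for a bounded Borel function `f` on `σ(A)`. -/
theorem exists_borel {f : A.spec → ℝ} (hm : Measurable f) (hb : ∃ C, ∀ x, |f x| ≤ C) :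
    ∃ T : H →L[ℂ] H, (∀ ψ, inner ℂ ψ (T ψ) = ((∫ x, f x ∂(A.spectralMeasure ψ) : ℝ) : ℂ)) ∧
      ∀ ψ, ‖T ψ‖ ^ 2 = ∫ x, f x ^ 2 ∂(A.spectralMeasure ψ) := by
  obtain ⟨C, hC⟩ := hb
  have hf : ∀ (μ : Measure A.spec) [IsFiniteMeasure μ], MemLp f 2 μ := fun μ _ =>
    MemLp.of_bound (C := C) hm.aestronglyMeasurable (ae_of_all _ hC)
  choose V hV using fun ψ => A.exists_vec ψ (hf (A.spectralMeasure ψ))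
  have mono : ∀ {μ ν : Measure A.spec} {g : ℕ → C(A.spec, ℝ)}, μ ≤ ν →
      Tendsto (fun n => eLpNorm (⇑(g n) - f) 2 ν) atTop (𝓝 0) →
      Tendsto (fun n => eLpNorm (⇑(g n) - f) 2 μ) atTop (𝓝 0) := fun h hg =>
    tendsto_of_tendsto_of_tendsto_of_le_of_le tendsto_const_nhds hg (fun _ => zero_le)
      (fun n => eLpNorm_mono_measure _ h)
  have hadd : ∀ φ ψ, V (φ + ψ) = V φ + V ψ := by
    intro φ ψ
    obtain ⟨g, hg⟩ := A.exists_approx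
      (A.spectralMeasure φ + A.spectralMeasure ψ + A.spectralMeasure (φ + ψ)) (hf _)
    have h1 := hV φ g (mono (by rw [add_assoc]; exact Measure.le_add_right le_rfl) hg)
    have h2 := hV ψ g (mono (Measure.le_add_right (Measure.le_add_left le_rfl)) hg)
    have h3 := hV (φ + ψ) g (mono (Measure.le_add_left le_rfl) hg)
    refine tendsto_nhds_unique h3 ?_
    simpa using h1.add h2
  have hsmul : ∀ (c : ℂ) ψ, V (c • ψ) = c • V ψ := by
    intro c ψ
    obtain ⟨g, hg⟩ := A.exists_approx (A.spectralMeasure ψ + A.spectralMeasure (c • ψ)) (hf _)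
    have h1 := hV ψ g (mono (Measure.le_add_right le_rfl) hg)
    have h3 := hV (c • ψ) g (mono (Measure.le_add_left le_rfl) hg)
    refine tendsto_nhds_unique h3 ?_
    simpa using h1.const_smul c
  have hsq : ∀ ψ, ‖V ψ‖ ^ 2 = ∫ x, f x ^ 2 ∂(A.spectralMeasure ψ) := by
    intro ψ
    obtain ⟨g, hg⟩ := A.exists_approx (A.spectralMeasure ψ) (hf _)
    have h1 := (hV ψ g hg).norm
    have h2 : Tendsto (fun n => (eLpNorm (g n) 2 (A.spectralMeasure ψ)).toReal) atTop
        (𝓝 (eLpNorm f 2 (A.spectralMeasure ψ)).toReal) := by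
      rw [tendsto_iff_dist_tendsto_zero]
      have h3 := (ENNReal.tendsto_toReal ENNReal.zero_ne_top).comp hg
      refine squeeze_zero (fun _ => dist_nonneg) (fun n => ?_) h3
      have hgn := A.memLp_continuous (g n) (A.spectralMeasure ψ)
      have e1 := eLpNorm_add_le (p := 2) (hgn.sub (hf (A.spectralMeasure ψ))).1
        (hf (A.spectralMeasure ψ)).1 (by norm_num)
      have e2 := eLpNorm_add_le (p := 2) ((hf (A.spectralMeasure ψ)).sub hgn).1
        hgn.1 (by norm_num)
      rw [sub_add_cancel] at e1 e2
      rw [eLpNorm_sub_comm] at e2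
      have t1 := ENNReal.toReal_mono
        (ENNReal.add_ne_top.2 ⟨(hgn.sub (hf _)).2.ne, (hf _).2.ne⟩) e1
      have t2 := ENNReal.toReal_mono
        (ENNReal.add_ne_top.2 ⟨(hgn.sub (hf _)).2.ne, hgn.2.ne⟩) e2
      rw [ENNReal.toReal_add (hgn.sub (hf _)).2.ne (hf _).2.ne] at t1
      rw [ENNReal.toReal_add (hgn.sub (hf _)).2.ne hgn.2.ne] at t2
      rw [Real.dist_eq, abs_le]
      simp only [Function.comp_apply]
      constructor <;> linarith
    simp_rw [norm_cfc] at h1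
    rw [tendsto_nhds_unique h1 h2, eLpNorm_two_toReal_sq (hf _)]
  have hbound : ∀ ψ, ‖V ψ‖ ≤ |C| * ‖ψ‖ := by
    intro ψ
    refine (pow_le_pow_iff_left₀ (norm_nonneg _) (by positivity) two_ne_zero).1 ?_
    rw [hsq, mul_pow, ← A.spectralMeasure_univ ψ]
    calc _ ≤ ∫ x, |C| ^ 2 ∂(A.spectralMeasure ψ) := by
          refine integral_mono_of_nonneg (ae_of_all _ fun x => sq_nonneg _)
            (integrable_const _) (ae_of_all _ fun x => ?_)
          exact sq_le_sq.2 (by rw [abs_abs]; exact (hC x).trans (le_abs_self C))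
      _ = _ := by simp [mul_comm]
  refine ⟨LinearMap.mkContinuous ⟨⟨V, hadd⟩, hsmul⟩ |C| hbound, fun ψ => ?_, hsq⟩
  change inner ℂ ψ (V ψ) = _
  obtain ⟨g, hg⟩ := A.exists_approx (A.spectralMeasure ψ) (hf _)
  have h1 : Tendsto (fun n => inner ℂ ψ (A.contCalc (g n) ψ)) atTop (𝓝 (inner ℂ ψ (V ψ))) :=
    tendsto_const_nhds.inner (hV ψ g hg)
  refine tendsto_nhds_unique h1 ?_
  simp_rw [← integral_spectralMeasure]
  refine (Complex.continuous_ofReal.tendsto _).comp ?_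
  refine tendsto_integral_of_L1' f hm.aestronglyMeasurable
    (Eventually.of_forall fun n => (A.memLp_continuous (g n) _).integrable (by norm_num)) ?_
  set K := (A.spectralMeasure ψ) Set.univ ^ (1 / (1 : ℝ≥0∞).toReal - 1 / (2 : ℝ≥0∞).toReal)
  have hK : K ≠ ∞ := ENNReal.rpow_ne_top_of_nonneg (by norm_num) (measure_ne_top _ _)
  have h4 : Tendsto (fun n => eLpNorm (⇑(g n) - f) 2 (A.spectralMeasure ψ) * K) atTop (𝓝 0) := by
    simpa using ENNReal.Tendsto.mul_const hg (Or.inr hK)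
  exact tendsto_of_tendsto_of_tendsto_of_le_of_le tendsto_const_nhds h4 (fun _ => zero_le)
    (fun n => eLpNorm_le_eLpNorm_mul_rpow_measure_univ (by norm_num)
      ((A.memLp_continuous (g n) _).sub (hf _)).1)

/-- `T` represents `f(A) = ∫ f(λ) dE_λ`: `⟨ψ, T ψ⟩ = ∫ f(λ) d⟨ψ, E_λ ψ⟩` for all `ψ`. -/
def IsBorelCalc (f : A.spec → ℝ) (T : H →L[ℂ] H) : Prop :=
  ∀ ψ, inner ℂ ψ (T ψ) = ((∫ x, f x ∂(A.spectralMeasure ψ) : ℝ) : ℂ)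

/-- A bounded Borel function `σ(A) → ℝ`. -/
structure BorelFn where
  /-- the underlying function -/
  toFun : A.spec → ℝ
  measurable : Measurable toFun
  bounded : ∃ C, ∀ x, |toFun x| ≤ C

variable {A}

theorem IsBorelCalc.unique {f : A.spec → ℝ} {S T : H →L[ℂ] H} (hS : A.IsBorelCalc f S)
    (hT : A.IsBorelCalc f T) : S = T :=
  ext_of_inner fun ψ => (hS ψ).trans (hT ψ).symm

theorem IsBorelCalc.isSelfAdjoint {f : A.spec → ℝ} {T : H →L[ℂ] H} (hT : A.IsBorelCalc f T) :
    IsSelfAdjoint T := by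
  rw [ContinuousLinearMap.isSelfAdjoint_iff_isSymmetric, LinearMap.isSymmetric_iff_inner_map_self_real]
  intro ψ
  have h := hT ψ
  change inner ℂ ψ ((T : H →ₗ[ℂ] H) ψ) = _ at h
  rw [inner_conj_symm, h, ← inner_conj_symm, h, Complex.conj_ofReal]

namespace BorelFn

theorem exists_op (f : A.BorelFn) : ∃ T : H →L[ℂ] H, A.IsBorelCalc f.toFun T :=
  (A.exists_borel f.measurable f.bounded).imp fun _ h => h.1

/-- The operator `f(A)`. -/
noncomputable def toOp (f : A.BorelFn) : SelfAdjointOp H where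
  toCLM := f.exists_op.choose
  isSelfAdjoint := f.exists_op.choose_spec.isSelfAdjoint

theorem toOp_spec (f : A.BorelFn) : A.IsBorelCalc f.toFun f.toOp.toCLM := f.exists_op.choose_spec

theorem norm_sq (f : A.BorelFn) (ψ : H) :
    ‖f.toOp.toCLM ψ‖ ^ 2 = ∫ x, f.toFun x ^ 2 ∂(A.spectralMeasure ψ) := by
  obtain ⟨T, hT, hT'⟩ := A.exists_borel f.measurable f.bounded
  rw [f.toOp_spec.unique hT, hT']

theorem integrable (f : A.BorelFn) (ψ : H) : Integrable f.toFun (A.spectralMeasure ψ) := by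
  obtain ⟨C, hC⟩ := f.bounded
  exact Integrable.of_bound f.measurable.aestronglyMeasurable C (ae_of_all _ hC)

/-- Pointwise product. -/
def mul (f g : A.BorelFn) : A.BorelFn where
  toFun x := f.toFun x * g.toFun x
  measurable := f.measurable.mul g.measurable
  bounded := by
    obtain ⟨C, hC⟩ := f.bounded
    obtain ⟨D, hD⟩ := g.bounded
    refine ⟨C * D, fun x => ?_⟩
    rw [abs_mul]
    exact mul_le_mul (hC x) (hD x) (abs_nonneg _) ((abs_nonneg _).trans (hC x))

/-- Pointwise sum. -/
def add (f g : A.BorelFn) : A.BorelFn where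
  toFun x := f.toFun x + g.toFun x
  measurable := f.measurable.add g.measurable
  bounded := by
    obtain ⟨C, hC⟩ := f.bounded
    obtain ⟨D, hD⟩ := g.bounded
    exact ⟨C + D, fun x => (abs_add_le _ _).trans (add_le_add (hC x) (hD x))⟩

/-- Constant function. -/
def const (A : SelfAdjointOp H) (c : ℝ) : A.BorelFn := ⟨fun _ => c, measurable_const, |c|, fun _ => le_rfl⟩

theorem toOp_add (f g : A.BorelFn) : (f.add g).toOp.toCLM = f.toOp.toCLM + g.toOp.toCLM := by
  refine (f.add g).toOp_spec.unique fun ψ => ?_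
  rw [add_apply, inner_add_right, f.toOp_spec, g.toOp_spec, ← Complex.ofReal_add,
    ← integral_add (f.integrable ψ) (g.integrable ψ)]
  rfl

theorem toOp_const (A : SelfAdjointOp H) (c : ℝ) : (const A c).toOp.toCLM = (c : ℂ) • (1 : H →L[ℂ] H) := by
  refine (const A c).toOp_spec.unique fun ψ => ?_
  have : (const A c).toFun = fun _ => c := rfl
  rw [this, integral_const, A.spectralMeasure_univ, smul_apply,
    inner_smul_right, one_apply_eq_self, inner_self_eq_norm_sq_to_K]
  simp [mul_comm]

theorem toOp_mul_self (f : A.BorelFn) : (f.mul f).toOp.toCLM = f.toOp.toCLM * f.toOp.toCLM := by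
  refine (f.mul f).toOp_spec.unique fun ψ => ?_
  have hs := ContinuousLinearMap.isSelfAdjoint_iff_isSymmetric.1 f.toOp.isSelfAdjoint
  have h1 : inner ℂ ψ ((f.toOp.toCLM * f.toOp.toCLM) ψ) = inner ℂ (f.toOp.toCLM ψ) (f.toOp.toCLM ψ) :=
    (hs ψ (f.toOp.toCLM ψ)).symm
  have h2 : (f.mul f).toFun = fun x => f.toFun x ^ 2 := funext fun x => (sq _).symm
  rw [h1, inner_self_eq_norm_sq_to_K, h2, ← f.norm_sq ψ]
  simp

theorem toOp_congr {f g : A.BorelFn} (h : ∀ x, f.toFun x = g.toFun x) : f.toOp = g.toOp := by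
  have : f.toFun = g.toFun := funext h
  ext1
  refine f.toOp_spec.unique ?_
  rw [this]
  exact g.toOp_spec

theorem toOp_mul_of_commute (f g : A.BorelFn) (hc : Commute f.toOp.toCLM g.toOp.toCLM) :
    (f.mul g).toOp.toCLM = f.toOp.toCLM * g.toOp.toCLM := by
  have h := (f.add g).toOp_mul_self
  rw [toOp_add] at h
  have h' : ((f.add g).mul (f.add g)).toOp =
      (((f.mul f).add (g.mul g)).add ((f.mul g).add (f.mul g))).toOp :=
    toOp_congr fun x => by simp only [mul, add]; ring
  rw [h', toOp_add, toOp_add, toOp_add, toOp_mul_self, toOp_mul_self, mul_add, add_mul, add_mul,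
    ← hc.eq] at h
  have h2 : (2 : ℂ) • (f.mul g).toOp.toCLM = (2 : ℂ) • (f.toOp.toCLM * g.toOp.toCLM) := by
    rw [two_smul, two_smul]
    have := congrArg (fun T => T - f.toOp.toCLM * f.toOp.toCLM - g.toOp.toCLM * g.toOp.toCLM) h
    convert this using 1 <;> abel
  exact smul_right_injective _ (two_ne_zero) h2

theorem toOp_polynomial (f : A.BorelFn) (p : Polynomial ℝ) :
    ∃ g : A.BorelFn, (∀ x, g.toFun x = p.eval (f.toFun x)) ∧
      g.toOp.toCLM = Polynomial.aeval f.toOp.toCLM p := by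
  have hpow : ∀ n : ℕ, ∃ g : A.BorelFn, (∀ x, g.toFun x = f.toFun x ^ n) ∧
      g.toOp.toCLM = f.toOp.toCLM ^ n := by
    intro n
    induction n with
    | zero => exact ⟨const A 1, fun x => by simp [const], by rw [toOp_const]; simp⟩
    | succ n ih =>
      obtain ⟨g, hg, hg'⟩ := ih
      refine ⟨f.mul g, fun x => by simp [mul, hg, pow_succ, mul_comm], ?_⟩
      rw [toOp_mul_of_commute, hg', pow_succ']
      rw [hg']
      exact Commute.self_pow _ _
  induction p using Polynomial.induction_on' with
  | add p q hp hq =>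
    obtain ⟨g, hg, hg'⟩ := hp
    obtain ⟨k, hk, hk'⟩ := hq
    exact ⟨g.add k, fun x => by simp [add, hg, hk], by rw [toOp_add, hg', hk', map_add]⟩
  | monomial n a =>
    obtain ⟨g, hg, hg'⟩ := hpow n
    refine ⟨(const A a).mul g, fun x => by simp [mul, const, hg], ?_⟩
    rw [toOp_mul_of_commute, hg', toOp_const, Polynomial.aeval_monomial,
      Algebra.algebraMap_eq_smul_one, Complex.coe_smul]
    rw [toOp_const]
    exact (Commute.one_left _).smul_left _

/-- The spectral measures of `f(A)` are the images under `f` of those of `A`. -/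
theorem map_spectralMeasure (f : A.BorelFn) (ψ : H) :
    (f.toOp.spectralMeasure ψ).map Subtype.val = (A.spectralMeasure ψ).map f.toFun := by
  set B := f.toOp with hB
  have hv : Measurable (Subtype.val : B.spec → ℝ) := measurable_subtype_coe
  have hpoly : ∀ p : Polynomial ℝ, ∫ x, p.eval (x : ℝ) ∂(B.spectralMeasure ψ) =
      ∫ x, p.eval (f.toFun x) ∂(A.spectralMeasure ψ) := by
    intro p
    obtain ⟨g, hg, hg'⟩ := f.toOp_polynomial p
    have h1 := g.toOp_spec ψ
    simp_rw [hg] at h1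
    rw [← Complex.ofReal_inj, ← h1, hg', ← cfc_polynomial p f.toOp.toCLM f.toOp.isSelfAdjoint,
      cfc_apply (fun x => p.eval x) f.toOp.toCLM f.toOp.isSelfAdjoint (by fun_prop)]
    exact B.integral_spectralMeasure ⟨fun x => p.eval (x : ℝ), by fun_prop⟩ ψ
  obtain ⟨C, hC⟩ := f.bounded
  obtain ⟨D, hD⟩ : ∃ D : ℝ, ∀ x : B.spec, |(x : ℝ)| ≤ D :=
    ⟨‖B.toCLM‖ * ‖(1 : H →L[ℂ] H)‖, fun x => spectrum.norm_le_norm_mul_of_mem x.2⟩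
  set R := max C D
  refine ext_of_forall_integral_eq_of_IsFiniteMeasure fun k => ?_
  rw [integral_map hv.aemeasurable k.continuous.aestronglyMeasurable,
    integral_map f.measurable.aemeasurable k.continuous.aestronglyMeasurable]
  refine eq_of_forall_dist_le fun ε hε => ?_
  set M := (A.spectralMeasure ψ).real Set.univ + (B.spectralMeasure ψ).real Set.univ + 1
  have hM : 0 < M := by positivity
  obtain ⟨p, hp⟩ := exists_polynomial_near_of_continuousOn (-R) R k k.continuous.continuousOn
    (ε / M) (by positivity)
  have hI : ∀ {X : Type _} [MeasurableSpace X] (μ : Measure X) [IsFiniteMeasure μ] (u : X → ℝ),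
      Measurable u → (∀ x, |u x| ≤ R) →
      |∫ x, k (u x) ∂μ - ∫ x, p.eval (u x) ∂μ| ≤ ε / M * μ.real Set.univ := by
    intro X _ μ _ u hu hR
    have i1 : Integrable (fun x => k (u x)) μ :=
      Integrable.of_bound (k.continuous.measurable.comp hu).aestronglyMeasurable ‖k‖
        (ae_of_all _ fun x => k.norm_coe_le_norm _)
    have hle : ∀ x, ‖k (u x) - p.eval (u x)‖ ≤ ε / M := fun x => by
      rw [Real.norm_eq_abs, abs_sub_comm]
      exact (hp (u x) (abs_le.1 (hR x))).le
    have i2 : Integrable (fun x => k (u x) - p.eval (u x)) μ :=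
      Integrable.of_bound ((k.continuous.measurable.comp hu).sub
        (p.continuous.measurable.comp hu)).aestronglyMeasurable _ (ae_of_all _ hle)
    have i3 : Integrable (fun x => p.eval (u x)) μ := by
      refine (i1.sub i2).congr (ae_of_all _ fun x => ?_)
      simp
    rw [← integral_sub i1 i3]
    exact norm_integral_le_of_norm_le_const (ae_of_all _ hle)
  have e1 := hI (B.spectralMeasure ψ) Subtype.val hv fun x => (hD x).trans (le_max_right _ _)
  have e2 := hI (A.spectralMeasure ψ) f.toFun f.measurable fun x => (hC x).trans (le_max_left _ _)
  rw [hpoly] at e1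
  have hsum : ε / M * (B.spectralMeasure ψ).real Set.univ +
      ε / M * (A.spectralMeasure ψ).real Set.univ ≤ ε := by
    rw [← mul_add, div_mul_eq_mul_div, div_le_iff₀ hM]
    exact mul_le_mul_of_nonneg_left (by simp only [M]; linarith) hε.le
  rw [Real.dist_eq]
  rw [abs_le] at e1 e2 ⊢
  constructor <;> linarith [e1.1, e1.2, e2.1, e2.2]

end BorelFn

/-- The identity function on the spectrum. -/
def BorelFn.id (A : SelfAdjointOp H) : A.BorelFn where
  toFun := Subtype.val
  measurable := measurable_subtype_coe
  bounded := ⟨‖A.toCLM‖ * ‖(1 : H →L[ℂ] H)‖, fun x => spectrum.norm_le_norm_mul_of_mem x.2⟩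

theorem BorelFn.toOp_id (A : SelfAdjointOp H) : (BorelFn.id A).toOp = A := by
  ext1
  refine (BorelFn.id A).toOp_spec.unique fun ψ => ?_
  have h := A.integral_spectralMeasure (ContinuousMap.restrict A.spec (ContinuousMap.id ℝ)) ψ
  rw [contCalc, cfcHom_id] at h
  exact h.symm

theorem BorelFn.integral_toOp (f : A.BorelFn) {g : ℝ → ℝ} (hg : Measurable g) (ψ : H) :
    ∫ x, g x ∂(f.toOp.spectralMeasure ψ) = ∫ x, g (f.toFun x) ∂(A.spectralMeasure ψ) := by
  rw [← integral_map f.measurable.aemeasurable hg.aestronglyMeasurable, ← f.map_spectralMeasure,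
    integral_map measurable_subtype_coe.aemeasurable hg.aestronglyMeasurable]

/-- The composite `g ∘ f` of Borel functions `f` on `σ(A)` and `g` on `σ(f(A))`. As `f` may leave
`σ(f(A))` on a null set, `g` is extended by zero to the real line. -/
noncomputable def BorelFn.comp (f : A.BorelFn) (g : f.toOp.BorelFn) : A.BorelFn where
  toFun x := Function.extend Subtype.val g.toFun 0 (f.toFun x)
  measurable := ((MeasurableEmbedding.subtype_coe
    (spectrum.isClosed (𝕜 := ℝ) f.toOp.toCLM).measurableSet).measurable_extend
      g.measurable measurable_zero).comp f.measurable
  bounded := by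
    obtain ⟨C, hC⟩ := g.bounded
    refine ⟨|C|, fun x => ?_⟩
    by_cases h : ∃ y : f.toOp.spec, (y : ℝ) = f.toFun x
    · obtain ⟨y, hy⟩ := h
      rw [← hy, Subtype.val_injective.extend_apply]
      exact (hC y).trans (le_abs_self C)
    · rw [Function.extend_apply' _ _ _ h]
      simp

theorem BorelFn.toOp_comp (f : A.BorelFn) (g : f.toOp.BorelFn) : (f.comp g).toOp = g.toOp := by
  ext1
  refine (f.comp g).toOp_spec.unique fun ψ => ?_
  rw [g.toOp_spec, Complex.ofReal_inj]
  have h := f.integral_toOp ((MeasurableEmbedding.subtype_coe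
    (spectrum.isClosed (𝕜 := ℝ) f.toOp.toCLM).measurableSet).measurable_extend
      g.measurable measurable_zero) ψ
  simp_rw [Subtype.val_injective.extend_apply] at h
  exact h

/-- `B ≤ A` if `B = f(A)` for some bounded Borel function `f` on `σ(A)`. The category of this
preorder, with one morphism `f_𝒪 : B ⟶ A` for each related pair, is the category `𝒪`. -/
instance : Preorder (SelfAdjointOp H) where
  le B A := ∃ f : A.BorelFn, B = f.toOp
  le_refl A := ⟨BorelFn.id A, (BorelFn.toOp_id A).symm⟩
  le_trans := by
    rintro C B A ⟨g, rfl⟩ ⟨f, rfl⟩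
    exact ⟨f.comp g, (f.toOp_comp g).symm⟩

/-- The morphism `f_𝒪 : f(A) ⟶ A`. -/
noncomputable def BorelFn.hom (f : A.BorelFn) : f.toOp ⟶ A := homOfLE ⟨f, rfl⟩

end SelfAdjointOp

/-- The projection operators on `H`, ordered by the usual order of operators. -/
abbrev Projector (H : Type*) [NormedAddCommGroup H] [InnerProductSpace ℂ H] [CompleteSpace H] :=
  {P : H →L[ℂ] H // IsStarProjection P}

namespace SelfAdjointOp

variable (A : SelfAdjointOp H)

/-- The characteristic function of a Borel subset of `σ(A)`. -/
noncomputable def charFn (Δ : Set A.spec) (hΔ : MeasurableSet Δ) : A.BorelFn where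
  toFun := Δ.indicator 1
  measurable := measurable_one.indicator hΔ
  bounded := ⟨1, fun x => by by_cases h : x ∈ Δ <;> simp [h]⟩

/-- The spectral projector `E[A ∈ Δ] = χ_Δ(A)`. -/
noncomputable def specProj (Δ : Set A.spec) (hΔ : MeasurableSet Δ) : Projector H :=
  ⟨(A.charFn Δ hΔ).toOp.toCLM, by
    refine ⟨?_, (A.charFn Δ hΔ).toOp.isSelfAdjoint⟩
    rw [IsIdempotentElem, ← BorelFn.toOp_mul_self]
    congr 1
    refine BorelFn.toOp_congr fun x => ?_
    by_cases h : x ∈ Δ <;> simp [BorelFn.mul, charFn, h]⟩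

/-- The spectral algebra `W_A` of all spectral projectors of `A`. -/
def W : Set (Projector H) := {P | ∃ (Δ : Set A.spec) (hΔ : MeasurableSet Δ), P = A.specProj Δ hΔ}

theorem inner_specProj (Δ : Set A.spec) (hΔ : MeasurableSet Δ) (ψ : H) :
    inner ℂ ψ ((A.specProj Δ hΔ).1 ψ) = (((A.spectralMeasure ψ).real Δ : ℝ) : ℂ) := by
  have h := (A.charFn Δ hΔ).toOp_spec ψ
  rw [show (A.charFn Δ hΔ).toFun = Δ.indicator 1 from rfl, integral_indicator_one hΔ] at h
  exact h

theorem norm_specProj_sq (Δ : Set A.spec) (hΔ : MeasurableSet Δ) (ψ : H) :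
    ‖(A.specProj Δ hΔ).1 ψ‖ ^ 2 = (A.spectralMeasure ψ).real Δ := by
  have h := (A.charFn Δ hΔ).norm_sq ψ
  rw [← integral_indicator_one hΔ]
  refine h.trans (integral_congr_ae (ae_of_all _ fun x => ?_))
  by_cases hx : x ∈ Δ <;> simp [charFn, hx]

theorem specProj_compl (Δ : Set A.spec) (hΔ : MeasurableSet Δ) :
    (A.specProj Δᶜ hΔ.compl).1 = 1 - (A.specProj Δ hΔ).1 := by
  refine ext_of_inner fun ψ => ?_
  rw [sub_apply, inner_sub_right, inner_specProj, inner_specProj, one_apply_eq_self,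
    measureReal_compl hΔ, A.spectralMeasure_univ, inner_self_eq_norm_sq_to_K]
  simp

theorem specProj_le {Δ₁ Δ₂ : Set A.spec} (h₁ : MeasurableSet Δ₁) (h₂ : MeasurableSet Δ₂)
    (h : ∀ ψ, A.spectralMeasure ψ Δ₁ ≤ A.spectralMeasure ψ Δ₂) :
    A.specProj Δ₁ h₁ ≤ A.specProj Δ₂ h₂ := by
  change (A.specProj Δ₁ h₁).1 ≤ (A.specProj Δ₂ h₂).1
  rw [ContinuousLinearMap.le_def, ContinuousLinearMap.isPositive_iff_complex]
  intro ψ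
  have hh : inner ℂ (((A.specProj Δ₂ h₂).1 - (A.specProj Δ₁ h₁).1) ψ) ψ =
      (((A.spectralMeasure ψ).real Δ₂ - (A.spectralMeasure ψ).real Δ₁ : ℝ) : ℂ) := by
    rw [← inner_conj_symm, sub_apply, inner_sub_right, inner_specProj, inner_specProj]
    simp
  rw [hh]
  refine ⟨by simp, ?_⟩
  have := ENNReal.toReal_mono (measure_ne_top _ _) (h ψ)
  simpa [Measure.real] using this

theorem le_specProj_iff (P : Projector H) (Δ : Set A.spec) (hΔ : MeasurableSet Δ) :
    P ≤ A.specProj Δ hΔ ↔ ∀ ψ, A.spectralMeasure (P.1 ψ) Δᶜ = 0 := by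
  change P.1 ≤ (A.specProj Δ hΔ).1 ↔ _
  rw [P.2.le_iff_mul_eq_right (A.specProj Δ hΔ).2]
  have key : ∀ ψ, A.spectralMeasure (P.1 ψ) Δᶜ = 0 ↔
      (A.specProj Δ hΔ).1 (P.1 ψ) = P.1 ψ := by
    intro ψ
    have h := A.norm_specProj_sq Δᶜ hΔ.compl (P.1 ψ)
    rw [specProj_compl] at h
    rw [← measureReal_eq_zero_iff, ← h, sq_eq_zero_iff, norm_eq_zero, sub_apply, sub_eq_zero,
      one_apply_eq_self, eq_comm]
  simp_rw [key]
  exact ⟨fun h ψ => congrArg (fun T : H →L[ℂ] H => T ψ) h, fun h => ContinuousLinearMap.ext h⟩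

theorem W_mono {A B : SelfAdjointOp H} (h : B ≤ A) : B.W ⊆ A.W := by
  obtain ⟨f, rfl⟩ := h
  rintro _ ⟨K, hK, rfl⟩
  have hK' : MeasurableSet (Subtype.val '' K) :=
    (spectrum.isClosed (𝕜 := ℝ) f.toOp.toCLM).measurableSet.subtype_image hK
  refine ⟨f.toFun ⁻¹' (Subtype.val '' K), f.measurable hK', Subtype.ext ?_⟩
  refine ext_of_inner fun ψ => ?_
  rw [inner_specProj, inner_specProj]
  congr 1
  rw [Measure.real, Measure.real, ← Measure.map_apply f.measurable hK', ← f.map_spectralMeasure,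
    Measure.map_apply measurable_subtype_coe hK', Set.preimage_image_eq _ Subtype.val_injective]

section Separable

variable [TopologicalSpace.SeparableSpace H]

/-- On a separable Hilbert space the spectral algebra is closed under the infima that define the
coarse-graining operation. -/
theorem exists_isGLB (B : SelfAdjointOp H) (P : Projector H) :
    ∃ Q : B.W, IsGLB {R : Projector H | R ∈ B.W ∧ P ≤ R} Q := by
  let d := TopologicalSpace.denseSeq H
  obtain ⟨ν, hν, hac, -⟩ := exists_isFiniteMeasure_absolutelyContinuous
    (Measure.sum fun n => B.spectralMeasure (d n))
  let S : Set (Set B.spec) := {Δ | MeasurableSet Δ ∧ ∀ ψ, B.spectralMeasure (P.1 ψ) Δᶜ = 0}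
  have hne : (ν '' S).Nonempty := ⟨_, Set.univ, ⟨MeasurableSet.univ, by simp⟩, rfl⟩
  obtain ⟨u, -, hu, huS⟩ := exists_seq_tendsto_sInf hne (OrderBot.bddBelow _)
  choose D hD hDu using huS
  let E := ⋂ n, D n
  have hES : E ∈ S := by
    refine ⟨MeasurableSet.iInter fun n => (hD n).1, fun ψ => ?_⟩
    rw [Set.compl_iInter]
    exact measure_iUnion_null fun n => (hD n).2 ψ
  have hEle : ν E ≤ sInf (ν '' S) :=
    ge_of_tendsto' hu fun n => (measure_mono (Set.iInter_subset D n)).trans_eq (hDu n)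
  refine ⟨⟨B.specProj E hES.1, E, hES.1, rfl⟩, IsLeast.isGLB ⟨⟨⟨E, hES.1, rfl⟩, ?_⟩, ?_⟩⟩
  · exact (B.le_specProj_iff P E hES.1).2 hES.2
  rintro _ ⟨⟨F, hF, rfl⟩, hPF⟩
  rw [le_specProj_iff] at hPF
  have hEF : E ∩ F ∈ S := by
    refine ⟨hES.1.inter hF, fun ψ => ?_⟩
    rw [Set.compl_inter]
    exact measure_union_null (hES.2 ψ) (hPF ψ)
  have h0 : ν (E \ F) = 0 := by
    have h1 := measure_inter_add_sdiff (μ := ν) E hF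
    have h2 : ν E ≤ ν (E ∩ F) := hEle.trans (sInf_le ⟨_, hEF, rfl⟩)
    rw [← h1] at h2
    by_contra hc
    exact absurd h2 (not_le.2 (ENNReal.lt_add_right (measure_ne_top _ _) hc))
  have h1 := hac h0
  rw [Measure.sum_apply _ (hES.1.diff hF), ENNReal.tsum_eq_zero] at h1
  have h2 : (B.specProj (E \ F) (hES.1.diff hF)).1 = 0 := by
    refine ContinuousLinearMap.coeFn_injective ?_
    refine Continuous.ext_on (TopologicalSpace.denseRange_denseSeq H)
      (ContinuousLinearMap.continuous _) (ContinuousLinearMap.continuous _) ?_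
    rintro _ ⟨n, rfl⟩
    have := B.norm_specProj_sq (E \ F) (hES.1.diff hF) (d n)
    rw [Measure.real, h1 n] at this
    simpa using this
  refine B.specProj_le hES.1 hF fun ψ => ?_
  have h3 := B.norm_specProj_sq (E \ F) (hES.1.diff hF) ψ
  rw [h2] at h3
  have h4 : B.spectralMeasure ψ (E \ F) = 0 := by
    rw [← measureReal_eq_zero_iff, ← h3]
    simp
  calc B.spectralMeasure ψ E = B.spectralMeasure ψ (E ∩ F) + B.spectralMeasure ψ (E \ F) :=
        (measure_inter_add_sdiff E hF).symm
    _ ≤ B.spectralMeasure ψ F := by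
        rw [h4, add_zero]
        exact measure_mono Set.inter_subset_right

/-- Coarse-graining of a projector `P` to the context `B`: the infimum, in the lattice of all
projectors, of the `Q ∈ W_B` with `P ≤ Q`. For `P = E[A ∈ Δ]` and `B = f(A)` this is
`E[f(A) ∈ f(Δ)] := inf {E[f(A) ∈ K] | E[A ∈ Δ] ≤ E[f(A) ∈ K]}`. -/
noncomputable def coarseGrain (B : SelfAdjointOp H) (P : Projector H) : B.W :=
  (B.exists_isGLB P).choose

theorem coarseGrain_isGLB (B : SelfAdjointOp H) (P : Projector H) :
    IsGLB {Q : Projector H | Q ∈ B.W ∧ P ≤ Q} (B.coarseGrain P : Projector H) :=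
  (B.exists_isGLB P).choose_spec

theorem coarseGrain_self (P : A.W) : A.coarseGrain P = P := by
  refine Subtype.ext ((A.coarseGrain_isGLB P).unique ?_)
  exact IsLeast.isGLB ⟨⟨P.2, le_rfl⟩, fun Q hQ => hQ.2⟩

theorem coarseGrain_coarseGrain {B C : SelfAdjointOp H} (h : C ≤ B) (P : Projector H) :
    C.coarseGrain (B.coarseGrain P) = C.coarseGrain P := by
  refine Subtype.ext ((C.coarseGrain_isGLB _).unique ?_)
  have : {Q : Projector H | Q ∈ C.W ∧ (B.coarseGrain P : Projector H) ≤ Q} =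
      {Q | Q ∈ C.W ∧ P ≤ Q} := by
    ext Q
    refine and_congr_right fun hQ => ⟨fun hle => ?_, fun hle => ?_⟩
    · exact ((B.coarseGrain_isGLB P).2 fun R hR => hR.2).trans hle
    · exact (B.coarseGrain_isGLB P).1 ⟨W_mono h hQ, hle⟩
  rw [this]
  exact C.coarseGrain_isGLB P

end Separable

end SelfAdjointOp

open SelfAdjointOp

section Valuations

universe u

variable (H : Type u) [NormedAddCommGroup H] [InnerProductSpace ℂ H] [CompleteSpace H]
  [TopologicalSpace.SeparableSpace H]

/-- The coarse-graining presheaf `G` on `𝒪`: `G(A) = W_A`, and for `B = f(A)` the map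
`G(f_𝒪) : W_A → W_B` is `E[A ∈ Δ] ↦ E[f(A) ∈ f(Δ)]`. -/
noncomputable def coarseGrainingPresheaf : (SelfAdjointOp H)ᵒᵖ ⥤ Type u where
  obj A := A.unop.W
  map {_ B} _ := ↾fun P => B.unop.coarseGrain P
  map_id A := by
    ext P : 3
    exact A.unop.coarseGrain_self P
  map_comp {_ B C} _ g := by
    ext P : 3
    exact (coarseGrain_coarseGrain (leOfHom g.unop) _).symm

/-- A generalized valuation: maps `ν_A : W_A → Ω(A)` to the sieves on `A` in `𝒪`. -/
structure GeneralizedValuation where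
  /-- the maps `ν_A` -/
  val (A : SelfAdjointOp H) : A.W → Sieve A
  /-- `ν_{h(A)}(E[h(A) ∈ h(Δ)]) = h_𝒪^*(ν_A(E[A ∈ Δ]))` -/
  functional_composition (A : SelfAdjointOp H) (h : A.BorelFn) (P : A.W) :
    val h.toOp (h.toOp.coarseGrain P) = (val A P).pullback h.hom
  null (A : SelfAdjointOp H) (P : A.W) : P.1.1 = 0 → val A P = ⊥
  monotone (A : SelfAdjointOp H) (P Q : A.W) : P.1 ≤ Q.1 → val A P ≤ val A Q
  exclusive (A : SelfAdjointOp H) (P Q : A.W) : P.1.1 * Q.1.1 = 0 → val A P = ⊤ → val A Q < ⊤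

end Valuations

end QuantumTopos

open QuantumTopos CategoryTheory Opposite

/-!
Every morphism of `𝒪` is `h_𝒪 : h(A) ⟶ A` for some bounded Borel `h`, so condition 1 on a
generalized valuation is exactly naturality of the maps `ν_A`. For any natural transformation
`N : F ⟶ Ω` into the presheaf of sieves, `f ∈ N(x)` iff `f^* N(x) = N(F(f) x)` is the maximal sieve:
thus `N` is determined by the sections it sends to the maximal sieve, and these form the only
subpresheaf with characteristic morphism `N`.
-/

namespace QuantumTopos

section SubpresheafClassification

universe w v u

variable {C : Type u} [Category.{v} C]

theorem sieveOfSection_eq_top_iff {F : Cᵒᵖ ⥤ Type w} (K : Subfunctor F) {X : Cᵒᵖ} (x : F.obj X) :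
    K.sieveOfSection x = ⊤ ↔ x ∈ K.obj X := by
  rw [← Sieve.id_mem_iff_eq_top, Subfunctor.sieveOfSection_apply, op_id, Functor.map_id_apply]

variable {F : Cᵒᵖ ⥤ Type max u v}

theorem χ_ι_app_apply (K : Subfunctor F) {X : Cᵒᵖ} (x : F.obj X) :
    (Presheaf.χ K.ι).app X x = K.sieveOfSection x :=
  Sieve.ext fun _ _ => ⟨fun ⟨a, ha⟩ => Set.mem_of_eq_of_mem ha a.2, fun h => ⟨⟨_, h⟩, rfl⟩⟩

/-- The subpresheaf classified by `N : F ⟶ Ω`, where `Ω` is the presheaf of sieves: the sections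
that `N` sends to the maximal sieve. -/
def classifiedSubfunctor (N : F ⟶ Functor.sieves C) : Subfunctor F where
  obj X := {x | N.app X x = (⊤ : Sieve X.unop)}
  map {X Y} f x hx := by
    have hx : N.app X x = (⊤ : Sieve X.unop) := hx
    change N.app Y (F.map f x) = (⊤ : Sieve Y.unop)
    rw [NatTrans.naturality_apply N f x, hx]
    exact Sieve.pullback_top

theorem sieveOfSection_classifiedSubfunctor (N : F ⟶ Functor.sieves C) {X : Cᵒᵖ} (x : F.obj X) :
    (classifiedSubfunctor N).sieveOfSection x = N.app X x := by
  refine Sieve.ext fun Y f => ?_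
  change N.app (op Y) (F.map f.op x) = (⊤ : Sieve Y) ↔ _
  rw [NatTrans.naturality_apply N f.op x]
  exact (Sieve.mem_iff_pullback_eq_top (S := (N.app X x : Sieve X.unop)) f).symm

theorem χ_ι_eq_iff_eq_classifiedSubfunctor (K : Subfunctor F) (N : F ⟶ Functor.sieves C) :
    Presheaf.χ K.ι = N ↔ K = classifiedSubfunctor N := by
  constructor
  · rintro rfl
    ext X x
    change x ∈ K.obj X ↔ (Presheaf.χ K.ι).app X x = (⊤ : Sieve X.unop)
    rw [χ_ι_app_apply]
    exact (sieveOfSection_eq_top_iff K x).symm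
  · rintro rfl
    ext X x
    exact (χ_ι_app_apply _ x).trans (sieveOfSection_classifiedSubfunctor N x)

end SubpresheafClassification

section FunctionalComposition

universe u

variable {H : Type u} [NormedAddCommGroup H] [InnerProductSpace ℂ H] [CompleteSpace H]
  [TopologicalSpace.SeparableSpace H] {val : ∀ A : SelfAdjointOp H, A.W → Sieve A}

/-- The functional composition principle for a family of sieve-valued maps on the spectral algebras:
the first of the four conditions in the definition of a generalized valuation. -/
def FunctionalComposition (val : ∀ A : SelfAdjointOp H, A.W → Sieve A) : Prop :=
  ∀ (A : SelfAdjointOp H) (h : A.BorelFn) (P : A.W),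
    val h.toOp (h.toOp.coarseGrain P) = (val A P).pullback h.hom

theorem FunctionalComposition.val_coarseGrain (hval : FunctionalComposition val)
    {A B : SelfAdjointOp H} (f : B ⟶ A) (P : A.W) :
    val B (B.coarseGrain P) = (val A P).pullback f := by
  obtain ⟨h, rfl⟩ := leOfHom f
  exact hval A h P

/-- The natural transformation `G ⟶ Ω` whose components are the maps of a family satisfying the
functional composition principle. For a generalized valuation `ν` this is `N^ν`. -/
noncomputable def FunctionalComposition.natTrans (hval : FunctionalComposition val) :
    coarseGrainingPresheaf H ⟶ Functor.sieves (SelfAdjointOp H) where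
  app A := ↾fun P => val A.unop P
  naturality {_ _} f := by
    ext P : 3
    exact hval.val_coarseGrain f.unop P

end FunctionalComposition

end QuantumTopos

theorem mainTheorem4_general {H : Type*} [NormedAddCommGroup H] [InnerProductSpace ℂ H]
    [CompleteSpace H] [TopologicalSpace.SeparableSpace H]
    {val : ∀ A : SelfAdjointOp H, A.W → Sieve A} (hval : FunctionalComposition val) :
    ∃ N : coarseGrainingPresheaf H ⟶ Functor.sieves (SelfAdjointOp H),
      (∀ (A : SelfAdjointOp H) (P : A.W), N.app (op A) P = val A P) ∧
      ∃ K : Subfunctor (coarseGrainingPresheaf H),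
        (∀ A : SelfAdjointOp H, K.obj (op A) = {P : A.W | val A P = ⊤}) ∧
        ∀ K' : Subfunctor (coarseGrainingPresheaf H),
          (Presheaf.classifier (SelfAdjointOp H)).χ K'.ι = N ↔ K' = K :=
  ⟨hval.natTrans, fun _ _ => rfl, classifiedSubfunctor hval.natTrans, fun _ => rfl,
    fun K' => χ_ι_eq_iff_eq_classifiedSubfunctor K' hval.natTrans⟩

theorem mainTheorem4 {H : Type*} [NormedAddCommGroup H] [InnerProductSpace ℂ H] [CompleteSpace H]
    [TopologicalSpace.SeparableSpace H] (ν : GeneralizedValuation H) :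
    ∃ N : coarseGrainingPresheaf H ⟶ Functor.sieves (SelfAdjointOp H),
      (∀ (A : SelfAdjointOp H) (P : A.W), N.app (op A) P = ν.val A P) ∧
      ∃ K : Subfunctor (coarseGrainingPresheaf H),
        (∀ A : SelfAdjointOp H, K.obj (op A) = {P : A.W | ν.val A P = ⊤}) ∧
        ∀ K' : Subfunctor (coarseGrainingPresheaf H),
          (Presheaf.classifier (SelfAdjointOp H)).χ K'.ι = N ↔ K' = K :=
  mainTheorem4_general ν.functional_composition
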